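/- Let $\mathbb{K}=\mathbb{R}$ or $\mathbb{C}$, let $n\ge 1$, and let $\mathcal{G}$ be an abelian subgroup of $GL(n,\mathbb{K})$, acting linearly on $\mathbb{K}^n$ by $(A,v)\mapsto Av$. Then $\mathcal{G}$ admits a minimal set in $\mathbb{K}^n\setminus\{0\}$; that is, there is a non-empty subset $E\subset\mathbb{K}^n\setminus\{0\}$ which is $\mathcal{G}$-invariant (i.e. $A(E)\subset E$ for all $A\in\mathcal{G}$), closed in $\mathbb{K}^n\setminus\{0\}$, and such that for every $v\in E$ the orbit $\mathcal{G}(v)=\{Av : A\in\mathcal{G}\}$ is dense in $E$. Equivalently, $E$ has no proper subset that is non-empty, $\mathcal{G}$-invariant and closed in $\mathbb{K}^n\setminus\{0\}$. -/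

import Mathlib

open scoped Matrix

/-- The orbit `G(v) = {A v : A ∈ G}` of a vector under the linear action of `G ≤ GL(n, 𝕜)`. -/
def linOrbit {𝕜 : Type*} [RCLike 𝕜] {n : ℕ} (G : Subgroup (GL (Fin n) 𝕜)) (v : Fin n → 𝕜) :
    Set (Fin n → 𝕜) :=
  {w | ∃ A ∈ G, w = (A : Matrix (Fin n) (Fin n) 𝕜) *ᵥ v}

/-- `E` is `G`-invariant: `A(E) ⊆ E` for every `A ∈ G`. -/
def IsLinInvariant {𝕜 : Type*} [RCLike 𝕜] {n : ℕ} (G : Subgroup (GL (Fin n) 𝕜))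
    (E : Set (Fin n → 𝕜)) : Prop :=
  ∀ A ∈ G, ∀ v ∈ E, (A : Matrix (Fin n) (Fin n) 𝕜) *ᵥ v ∈ E

/-- `E` is a minimal set of `G` in `V` (`V` is meant to be open and `G`-invariant): a non-empty
`G`-invariant subset of `V`, closed in `V`, in which every orbit is dense. -/
structure IsMinimalSetIn {𝕜 : Type*} [RCLike 𝕜] {n : ℕ} (G : Subgroup (GL (Fin n) 𝕜))
    (V E : Set (Fin n → 𝕜)) : Prop where
  subset : E ⊆ V
  nonempty : E.Nonempty
  invariant : IsLinInvariant G E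
  closed_in : closure E ∩ V ⊆ E
  dense_orbit : ∀ v ∈ E, E ⊆ closure (linOrbit G v)

/-- For invariant `V`, minimality in the sense above is minimality for inclusion among
the non-empty `G`-invariant subsets of `V` that are closed in `V`. -/
theorem isMinimalSetIn_iff_minimal {𝕜 : Type*} [RCLike 𝕜] {n : ℕ}
    (G : Subgroup (GL (Fin n) 𝕜)) (V E : Set (Fin n → 𝕜)) (hV : IsLinInvariant G V) :
    IsMinimalSetIn G V E ↔
      Minimal (fun F : Set (Fin n → 𝕜) =>
        F ⊆ V ∧ F.Nonempty ∧ IsLinInvariant G F ∧ closure F ∩ V ⊆ F) E := by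
  constructor
  · intro h
    refine ⟨⟨h.subset, h.nonempty, h.invariant, h.closed_in⟩, ?_⟩
    rintro F ⟨-, ⟨v, hv⟩, hFi, hFc⟩ hFE x hx
    refine hFc ⟨closure_mono ?_ (h.dense_orbit v (hFE hv) hx), h.subset hx⟩
    rintro w ⟨A, hA, rfl⟩
    exact hFi A hA v hv
  · rintro ⟨⟨hs, hne, hi, hc⟩, hmin⟩
    refine ⟨hs, hne, hi, hc, fun v hv => ?_⟩
    have hO : linOrbit G v ⊆ E := by
      rintro w ⟨A, hA, rfl⟩
      exact hi A hA v hv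
    have key : E ⊆ closure (linOrbit G v) ∩ V := by
      refine hmin ⟨Set.inter_subset_right, ⟨v, subset_closure ⟨1, G.one_mem, by simp⟩, hs hv⟩,
        ?_, ?_⟩ ?_
      · rintro A hA w ⟨hw, hwV⟩
        refine ⟨?_, hV A hA w hwV⟩
        have hcont : Continuous
            (fun u : Fin n → 𝕜 => (A : Matrix (Fin n) (Fin n) 𝕜) *ᵥ u) := by fun_prop
        refine map_mem_closure hcont hw ?_
        rintro u ⟨B, hB, rfl⟩
        exact ⟨A * B, G.mul_mem hA hB, by simp [Matrix.mulVec_mulVec]⟩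
      · rintro w ⟨hw, hwV⟩
        exact ⟨closure_minimal Set.inter_subset_left isClosed_closure hw, hwV⟩
      · rintro w ⟨hw, hwV⟩
        exact hc ⟨closure_mono hO hw, hwV⟩
    exact key.trans Set.inter_subset_left

/-! Let `𝒜` be the algebra generated by `G`, and `W` a minimal nonzero `𝒜`-stable subspace, so that
`𝒜w = W` for every nonzero `w ∈ W`. Let such a `w` be a limit of orbit points `x = Av`, with `v ∈
W`. Write `x = s(x)w` with `s(x) ∈ 𝒜` continuous in `x` and `s(w) = 1`. By commutativity `A⁻¹w =
s(x)⁻¹v`, which tends to `v`. Thus `v` lies in the closure of the orbit of `w`: any nonzero `v ∈ W`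
has an orbit closure that is minimal once `0` is removed. -/

theorem self_mem_linOrbit {𝕜 : Type*} [RCLike 𝕜] {n : ℕ} (G : Subgroup (GL (Fin n) 𝕜))
    (v : Fin n → 𝕜) : v ∈ linOrbit G v :=
  ⟨1, G.one_mem, by simp⟩

theorem IsLinInvariant.linOrbit_subset {𝕜 : Type*} [RCLike 𝕜] {n : ℕ}
    {G : Subgroup (GL (Fin n) 𝕜)} {E : Set (Fin n → 𝕜)} (hE : IsLinInvariant G E)
    {v : Fin n → 𝕜} (hv : v ∈ E) : linOrbit G v ⊆ E := by
  rintro w ⟨A, hA, rfl⟩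
  exact hE A hA v hv

theorem isLinInvariant_linOrbit {𝕜 : Type*} [RCLike 𝕜] {n : ℕ} (G : Subgroup (GL (Fin n) 𝕜))
    (v : Fin n → 𝕜) : IsLinInvariant G (linOrbit G v) := by
  rintro A hA _ ⟨B, hB, rfl⟩
  exact ⟨A * B, G.mul_mem hA hB, by simp [Matrix.mulVec_mulVec]⟩

theorem IsLinInvariant.closure {𝕜 : Type*} [RCLike 𝕜] {n : ℕ}
    {G : Subgroup (GL (Fin n) 𝕜)} {E : Set (Fin n → 𝕜)} (hE : IsLinInvariant G E) :
    IsLinInvariant G (closure E) := fun A hA _ hv =>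
  map_mem_closure (f := fun u => (A : Matrix (Fin n) (Fin n) 𝕜) *ᵥ u) (by fun_prop) hv (hE A hA)

theorem isLinInvariant_ne_zero {𝕜 : Type*} [RCLike 𝕜] {n : ℕ} (G : Subgroup (GL (Fin n) 𝕜)) :
    IsLinInvariant G {v | v ≠ 0} := by
  intro A _ v hv h
  apply hv
  have := congrArg (fun u => ((A⁻¹ : GL (Fin n) 𝕜) : Matrix (Fin n) (Fin n) 𝕜) *ᵥ u) h
  simpa only [Matrix.mulVec_mulVec, Matrix.mulVec_zero, Units.inv_mul, Matrix.one_mulVec] using this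

/-- The algebra of matrices generated by a linear group. -/
def linAlgebra {𝕜 : Type*} [RCLike 𝕜] {n : ℕ} (G : Subgroup (GL (Fin n) 𝕜)) :
    Subalgebra 𝕜 (Matrix (Fin n) (Fin n) 𝕜) :=
  Algebra.adjoin 𝕜 {M | ∃ A ∈ G, (A : Matrix (Fin n) (Fin n) 𝕜) = M}

theorem coe_mem_linAlgebra {𝕜 : Type*} [RCLike 𝕜] {n : ℕ} {G : Subgroup (GL (Fin n) 𝕜)}
    {A : GL (Fin n) 𝕜} (hA : A ∈ G) : (A : Matrix (Fin n) (Fin n) 𝕜) ∈ linAlgebra G :=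
  Algebra.subset_adjoin ⟨A, hA, rfl⟩

theorem commute_of_mem_linAlgebra {𝕜 : Type*} [RCLike 𝕜] {n : ℕ} {G : Subgroup (GL (Fin n) 𝕜)}
    (hG : ∀ A ∈ G, ∀ B ∈ G, A * B = B * A) {M : Matrix (Fin n) (Fin n) 𝕜}
    (hM : M ∈ linAlgebra G) {A : GL (Fin n) 𝕜} (hA : A ∈ G) :
    (A : Matrix (Fin n) (Fin n) 𝕜) * M = M * A := by
  have hle : linAlgebra G ≤ Subalgebra.centralizer 𝕜 {(A : Matrix (Fin n) (Fin n) 𝕜)} := by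
    refine Algebra.adjoin_le ?_
    rintro _ ⟨B, hB, rfl⟩
    rw [SetLike.mem_coe, Subalgebra.mem_centralizer_iff]
    rintro _ rfl
    exact congrArg Units.val (hG A hA B hB)
  exact Subalgebra.mem_centralizer_iff 𝕜 |>.1 (hle hM) _ rfl

/-- If `w` generates the invariant subspace `W` as a module over the algebra of `G`, then there is
a continuous family of matrices in that algebra, equal to `1` at `w`, sending `w` to each
nearby point of `W`. -/
theorem exists_continuous_mulVec_eq {𝕜 : Type*} [RCLike 𝕜] {n : ℕ}
    (G : Subgroup (GL (Fin n) 𝕜)) (W : Submodule 𝕜 (Fin n → 𝕜)) (w : Fin n → 𝕜)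
    (hw : ∀ x ∈ W, ∃ M ∈ linAlgebra G, M *ᵥ w = x) :
    ∃ s : (Fin n → 𝕜) → Matrix (Fin n) (Fin n) 𝕜, Continuous s ∧ s w = 1 ∧
      (∀ x, s x ∈ linAlgebra G) ∧ (w ∈ W → ∀ x ∈ W, s x *ᵥ w = x) := by
  let T : linAlgebra G →ₗ[𝕜] (Fin n → 𝕜) :=
    (Matrix.mulVecBilin 𝕜 𝕜).flip w ∘ₗ (linAlgebra G).val.toLinearMap
  -- A linear section of `M ↦ M *ᵥ w` over its range, extended linearly to the whole space;
  -- continuity is then automatic in finite dimension.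
  obtain ⟨r, hr⟩ := T.rangeRestrict.exists_rightInverse_of_surjective T.range_rangeRestrict
  obtain ⟨t, ht⟩ := r.exists_extend
  have key : ∀ x ∈ W, (t x : Matrix (Fin n) (Fin n) 𝕜) *ᵥ w = x := by
    intro x hx
    obtain ⟨M, hM, hMx⟩ := hw x hx
    have hxT : x ∈ LinearMap.range T := ⟨⟨M, hM⟩, hMx⟩
    have h1 : t x = r ⟨x, hxT⟩ := LinearMap.congr_fun ht ⟨x, hxT⟩
    have h2 := congrArg Subtype.val (LinearMap.congr_fun hr ⟨x, hxT⟩)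
    rw [h1]
    exact h2
  have hc : Continuous ((linAlgebra G).val.toLinearMap ∘ₗ t) :=
    LinearMap.continuous_of_finiteDimensional _
  -- `t w` fixes `w` but need not be `1`; replacing it by `1` leaves the value at `w` unchanged.
  refine ⟨fun x => (t x : Matrix (Fin n) (Fin n) 𝕜) - t w + 1, ?_, by simp, fun x =>
    add_mem (sub_mem (t x).2 (t w).2) (one_mem _), fun hwW x hx => ?_⟩
  · exact (hc.sub continuous_const).add continuous_const
  · rw [Matrix.add_mulVec, Matrix.sub_mulVec, key x hx, key w hwW, Matrix.one_mulVec,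
      sub_add_cancel]

/-- Orbit closures are symmetric on an invariant subspace that is generated, over the algebra of
the abelian group `G`, by the limit point. -/
theorem mem_closure_linOrbit_symm {𝕜 : Type*} [RCLike 𝕜] {n : ℕ} {G : Subgroup (GL (Fin n) 𝕜)}
    (hG : ∀ A ∈ G, ∀ B ∈ G, A * B = B * A) {W : Submodule 𝕜 (Fin n → 𝕜)}
    (hW : IsLinInvariant G (W : Set (Fin n → 𝕜))) {v w : Fin n → 𝕜} (hv : v ∈ W) (hwW : w ∈ W)
    (hgen : ∀ x ∈ W, ∃ M ∈ linAlgebra G, M *ᵥ w = x) (hw : w ∈ closure (linOrbit G v)) :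
    v ∈ closure (linOrbit G w) := by
  obtain ⟨s, hsc, hs1, hsA, hsw⟩ := exists_continuous_mulVec_eq G W w hgen
  have hinv : ContinuousAt (fun x => (s x)⁻¹ *ᵥ v) w := by
    have h1 : ContinuousAt (fun x => (s x)⁻¹) w := by
      refine ContinuousAt.comp (g := Inv.inv) (continuousAt_matrix_inv _ ?_) hsc.continuousAt
      rw [hs1, Matrix.det_one, Ring.inverse_eq_inv']
      exact continuousAt_inv₀ one_ne_zero
    exact (show Continuous fun M : Matrix (Fin n) (Fin n) 𝕜 => M *ᵥ v by
      fun_prop).continuousAt.comp h1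
  have hdet : ∀ᶠ x in nhds w, (s x).det ≠ 0 :=
    hsc.matrix_det.continuousAt.eventually_ne (by simp [hs1])
  have hmem : ∃ᶠ x in nhds w, (s x)⁻¹ *ᵥ v ∈ linOrbit G w := by
    refine ((mem_closure_iff_frequently.1 hw).and_eventually hdet).mono ?_
    rintro _ ⟨⟨A, hA, rfl⟩, hd⟩
    refine ⟨A⁻¹, G.inv_mem hA, ?_⟩
    set S := s ((A : Matrix (Fin n) (Fin n) 𝕜) *ᵥ v)
    have hS : S *ᵥ w = (A : Matrix (Fin n) (Fin n) 𝕜) *ᵥ v := hsw hwW _ (hW A hA v hv)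
    have hv' : v = S *ᵥ (((A⁻¹ : GL (Fin n) 𝕜) : Matrix (Fin n) (Fin n) 𝕜) *ᵥ w) := by
      rw [Matrix.mulVec_mulVec, ← commute_of_mem_linAlgebra hG (hsA _) (G.inv_mem hA),
        ← Matrix.mulVec_mulVec, hS, Matrix.mulVec_mulVec, Units.inv_mul, Matrix.one_mulVec]
    conv_lhs => rw [hv']
    rw [Matrix.mulVec_mulVec, Matrix.nonsing_inv_mul _ (isUnit_iff_ne_zero.2 hd),
      Matrix.one_mulVec]
  have := mem_closure_of_frequently_of_tendsto hmem hinv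
  simpa [hs1] using this

/-- A linear group has a nonzero invariant subspace generated, over the algebra of the group, by
each of its nonzero vectors. -/
theorem exists_irreducible_submodule {𝕜 : Type*} [RCLike 𝕜] {n : ℕ} (hn : 1 ≤ n)
    (G : Subgroup (GL (Fin n) 𝕜)) :
    ∃ W : Submodule 𝕜 (Fin n → 𝕜), W ≠ ⊥ ∧ IsLinInvariant G (W : Set (Fin n → 𝕜)) ∧
      ∀ w ∈ W, w ≠ 0 → ∀ x ∈ W, ∃ M ∈ linAlgebra G, M *ᵥ w = x := by
  have : Nonempty (Fin n) := ⟨⟨0, hn⟩⟩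
  obtain ⟨W, ⟨hW0, hWi⟩, hmin⟩ := exists_minimal_of_wellFoundedLT
    (fun W : Submodule 𝕜 (Fin n → 𝕜) =>
      W ≠ ⊥ ∧ ∀ M ∈ linAlgebra G, ∀ v ∈ W, M *ᵥ v ∈ W)
    ⟨⊤, top_ne_bot, fun _ _ _ _ => Submodule.mem_top⟩
  refine ⟨W, hW0, fun A hA => hWi _ (coe_mem_linAlgebra hA), fun w hw hw0 x hx => ?_⟩
  let U : Submodule 𝕜 (Fin n → 𝕜) :=
    (Subalgebra.toSubmodule (linAlgebra G)).map ((Matrix.mulVecBilin 𝕜 𝕜).flip w)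
  have hwU : w ∈ U := ⟨1, one_mem (linAlgebra G), Matrix.one_mulVec w⟩
  have hUW : U ≤ W := by
    rintro _ ⟨M, hM, rfl⟩
    exact hWi M hM w hw
  -- `U = 𝒜w` is nonzero and `𝒜`-stable, so minimality of `W` applies.
  have hWU : W ≤ U := by
    refine hmin ⟨fun h => hw0 ((Submodule.mem_bot 𝕜).1 (h ▸ hwU)), ?_⟩ hUW
    rintro M hM _ ⟨N, hN, rfl⟩
    exact ⟨M * N, mul_mem (S := Subalgebra 𝕜 _) hM hN, (Matrix.mulVec_mulVec w M N).symm⟩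
  exact hWU hx

theorem corollary1p3 {𝕜 : Type*} [RCLike 𝕜] (n : ℕ) (hn : 1 ≤ n)
    (G : Subgroup (GL (Fin n) 𝕜)) (hG : ∀ A ∈ G, ∀ B ∈ G, A * B = B * A) :
    ∃ E : Set (Fin n → 𝕜), IsMinimalSetIn G {v | v ≠ 0} E := by
  obtain ⟨W, hW0, hWi, hgen⟩ := exists_irreducible_submodule hn G
  obtain ⟨v, hv, hv0⟩ := W.ne_bot_iff.1 hW0
  refine ⟨closure (linOrbit G v) ∩ {v | v ≠ 0}, Set.inter_subset_right,
    ⟨v, subset_closure (self_mem_linOrbit G v), hv0⟩, ?_, ?_, ?_⟩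
  · exact fun A hA w hw => ⟨(isLinInvariant_linOrbit G v).closure A hA w hw.1,
      isLinInvariant_ne_zero G A hA w hw.2⟩
  · exact fun w hw => ⟨closure_minimal Set.inter_subset_left isClosed_closure hw.1, hw.2⟩
  · rintro w ⟨hw, hw0⟩
    have hwW : w ∈ W :=
      closure_minimal (hWi.linOrbit_subset hv) W.closed_of_finiteDimensional hw
    have hvw := mem_closure_linOrbit_symm hG hWi hv hwW (hgen w hwW hw0) hw
    exact Set.inter_subset_left.trans (closure_minimal
      ((isLinInvariant_linOrbit G w).closure.linOrbit_subset hvw) isClosed_closure)
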